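/- An $\alpha$-perturbation of $\mathbb N$ is a sequence $x_n=n+\alpha(n)$, $n\in\mathbb N=\{0,1,2,\dots\}$, where $\alpha:\mathbb N\to(-1,1)$, $\alpha(0)=0$, and, for some $r\in(0,1)$, $\alpha(n+1)-\alpha(n)\ge r-1$ for all $n$. Put $x_0!=1$, $x_n!=x_1x_2\cdots x_n$, $\mathcal N(t)=\sum_{n\ge0}t^n/x_n!$, $\mu_n=\frac1{x_n!}\int_0^\infty\frac{t^n}{\mathcal N(t)}\,dt$, and let $\tilde x_0=0$, $\tilde x_n=\frac{\mu_n}{\mu_{n-1}}x_n$ $(n\ge1)$ be the renormalized sequence. **(1)** Let $x_n=n+\alpha(n)$ be an $\alpha$-perturbation of $\mathbb N$ such that $\alpha$ extends to a function $\mathbb R^+\to\mathbb R$, $x\mapsto\alpha(x)$, that is almost everywhere twice differentiable. Suppose that $|\alpha'(x)|\ll1$ and $x|\alpha''(x)|\ll1$ for almost all large $x$, where $f\ll1$ means only that $f$ is bounded by a constant (in particular, it is enough that $\alpha'(x)\to0$ and $x\alpha''(x)\to0$). Then the series $\sum_n t^n/x_n!$ converges for every real $t$, the integrals below converge for every $m$,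 and $$\mu_m=\int_0^\infty\frac{t^m/x_m!}{\sum_{n=0}^\infty t^n/x_n!}\,dt\;\longrightarrow\;1\qquad(m\to\infty).$$ Consequently the renormalization is asymptotically trivial: $\tilde x_n/x_n\to1$ as $n\to\infty$. **(2)** This applies to the rescaled $\beta$-integers of quadratic PV units. Let $\beta>1$ be a quadratic Pisot–Vijayaraghavan unit, that is, an algebraic integer of degree $2$ whose conjugate has modulus less than $1$ and whose minimal polynomial has constant term $\pm1$. The set $\mathbb Z_\beta^+$ of real numbers $x\ge0$ whose greedy expansion in base $\beta$ contains only nonnegative powers of $\beta$ can be listed as a strictly increasing sequence $(b_n)_{n\ge0}$, the limit $c_\beta=\lim_n b_n/n$ exists and is positive, and the sequence $x_n=b_n/c_\beta$ is an $\alpha$-perturbation of $\mathbb N$ that satisfies the hypotheses of (1); hence $\mu_m\to1$ and $\tilde x_n/x_n\to1$ for it. -/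

import Mathlib

open MeasureTheory Filter Topology Set

noncomputable section

namespace DelonePerturbation

/-- `n ↦ α n` defines an `α`-perturbation `x n = n + α n` of the natural numbers: `α` takes values
in `(-1, 1)`, `α 0 = 0`, and the jumps of `α` are at least `r - 1` for some `r ∈ (0, 1)`.
The sequence `x` is then automatically a Delone sequence: consecutive terms differ by at least `r`,
and `|x n - n| < 1` makes it relatively dense. -/
structure IsAlphaPerturbation (α : ℕ → ℝ) : Prop where
  zero : α 0 = 0
  mem_Ioo : ∀ n, α n ∈ Ioo (-1 : ℝ) 1
  jumps : ∃ r ∈ Ioo (0 : ℝ) 1, ∀ n, r - 1 ≤ α (n + 1) - α n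

/-- The set of points at which `A` has a derivative. -/
def derivDomain (A : ℝ → ℝ) : Set ℝ := {y | DifferentiableAt ℝ A y}

/-- The second derivative of `A`: the derivative of `A'`, where `A'` is regarded as a function on
the set where it exists. -/
def secondDeriv (A : ℝ → ℝ) (x : ℝ) : ℝ := derivWithin (deriv A) (derivDomain A) x

/-- `A` extends `α` from `ℕ` to `ℝ⁺`, is almost everywhere twice differentiable on `ℝ⁺`, and
satisfies `|A' x| ≪ 1` and `x |A'' x| ≪ 1` for almost every large `x` (where `f ≪ 1` means that
`f` is bounded by a constant). Only the values of `A` on `[0, ∞)` play a role. -/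
structure IsMildExtension (α : ℕ → ℝ) (A : ℝ → ℝ) : Prop where
  extend : ∀ n : ℕ, A n = α n
  twice_differentiable : ∀ᵐ x ∂(volume.restrict (Ioi (0 : ℝ))),
    DifferentiableAt ℝ A x ∧ DifferentiableWithinAt ℝ (deriv A) (derivDomain A) x
  deriv_bound : ∃ C X : ℝ, ∀ᵐ x : ℝ, X ≤ x → |deriv A x| ≤ C
  secondDeriv_bound : ∃ C X : ℝ, ∀ᵐ x : ℝ, X ≤ x → x * |secondDeriv A x| ≤ C

/-- The generalized factorial `x_n! = x_1 x_2 ⋯ x_n`, with `x_0! = 1`. -/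
def seqFactorial (x : ℕ → ℝ) (n : ℕ) : ℝ := ∏ k ∈ Finset.range n, x (k + 1)

/-- The generalized exponential `𝓝(t) = ∑ n, t ^ n / x_n!`. -/
def seqExp (x : ℕ → ℝ) (t : ℝ) : ℝ := ∑' n : ℕ, t ^ n / seqFactorial x n

/-- The moment ratio `μ_n = (∫_0^∞ t ^ n / 𝓝(t) dt) / x_n!`. -/
def momentRatio (x : ℕ → ℝ) (n : ℕ) : ℝ :=
  (∫ t in Ioi (0 : ℝ), t ^ n / seqExp x t) / seqFactorial x n

/-- The renormalized sequence: `x̃_0 = 0` and `x̃_n = (μ_n / μ_{n-1}) x_n` for `n ≥ 1`. -/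
def renormalized (x : ℕ → ℝ) : ℕ → ℝ
  | 0 => 0
  | n + 1 => momentRatio x (n + 1) / momentRatio x n * x (n + 1)

/-- `β` is a quadratic Pisot-Vijayaraghavan unit: a real algebraic integer `β > 1` of degree two,
whose other conjugate has modulus less than one and whose minimal polynomial has constant
coefficient `1` or `-1`. -/
structure IsQuadraticPVUnit (β : ℝ) : Prop where
  isIntegral : IsIntegral ℤ β
  one_lt : 1 < β
  natDegree_minpoly : (minpoly ℤ β).natDegree = 2
  conjugates : ∀ z ∈ (minpoly ℤ β).aroots ℂ, z ≠ (β : ℂ) → ‖z‖ < 1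
  isUnit : IsUnit ((minpoly ℤ β).coeff 0)

/-- The map `y ↦ {β y}` that computes successive remainders in the greedy algorithm; the digit
produced at the same step is `⌊β y⌋`. -/
def greedyStep (β y : ℝ) : ℝ := Int.fract (β * y)

/-- The nonnegative `β`-integers: the `x ≥ 0` whose greedy expansion in base `β` contains only
nonnegative powers of `β`. For `0 ≤ x < β ^ k` the greedy algorithm started from `x / β ^ k`
produces in its first `k` steps the digits of `β ^ (k - 1), …, β ^ 0`, so the condition is that
the remainder is zero after these steps. (Enlarging `k` only adds leading zero digits.) -/
def betaIntegers (β : ℝ) : Set ℝ :=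
  {x | 0 ≤ x ∧ ∃ k : ℕ, x < β ^ k ∧ (greedyStep β)^[k] (x / β ^ k) = 0}

end DelonePerturbation

end

/-! Write w_n = n!/x_n!, and let p_n(t) be the Poisson weights. After cancelling e^t, the integrand
of μ_m is w_m p_m(t) / E[w_N] with N Poisson of parameter t. The bracket n < x_{n+1} < n + 2 makes
w_n / n nonincreasing for n ≥ 1 and (n + 1) w_n nondecreasing, so w_n / w_m and its inverse are at
most R(n, m) = 1 + K |n - m| (1/(n+1) + 1/(m+1)) (`IsBracketed.weight_le`). Jensen's inequality for
u ↦ 1/u then places the integrand between p_m (2 - E[R(N, m)]) and p_m E[R(N, m)]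
(`IsBracketed.integrand_bounds`).

Integrating over t mixes the Poisson laws into the negative binomial law ∫ p_n p_m dt, with mean m +
1 and variance 2(m + 1). Hence |N - m| is typically of order √m, the mean of R is 1 + O(m^(-1/2)),
and μ_m → 1.

For a quadratic unit, β = a ± 1/β with a an integer. The β-integers are the p + q/β ≥ 0 whose
conjugate p ∓ βq lies in a window: (-1, β) for norm -1, [0, β) for norm 1. To prove this it suffices
that the greedy step carries the largest window point below y to the largest one below βy
(`betaIntegers_eq`). Solving the window condition for one coordinate yields n - δ⌊(n + e)/θ⌋, which
differs from a linear function by a bounded sawtooth; rescaling gives an α-perturbation, and its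
piecewise linear interpolation is a mild extension. -/

namespace DelonePerturbation

/-! ### Negative binomial weights -/

/-- The probability of `n` successes before the `(m + 1)`-st failure in fair coin tosses. -/
noncomputable def negBinomial (m n : ℕ) : ℝ := ((n + m).choose m : ℝ) * (1 / 2) ^ (n + m + 1)

lemma negBinomial_nonneg (m n : ℕ) : 0 ≤ negBinomial m n := by
  unfold negBinomial; positivity

lemma hasSum_negBinomial (m : ℕ) : HasSum (negBinomial m) 1 := by
  have h := (hasSum_choose_mul_geometric_of_norm_lt_one m
    (r := (1 / 2 : ℝ)) (by norm_num)).mul_right ((1 / 2 : ℝ) ^ (m + 1))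
  have e : 1 / (1 - 1 / 2 : ℝ) ^ (m + 1) * (1 / 2) ^ (m + 1) = 1 := by
    rw [show (1 - 1 / 2 : ℝ) = 1 / 2 by norm_num]
    field_simp
  rw [e] at h
  refine h.congr_fun (fun n => ?_)
  unfold negBinomial
  rw [show n + m + 1 = n + (m + 1) by ring, pow_add]
  ring

lemma negBinomial_eq (m n : ℕ) :
    negBinomial m n = (n + m).factorial / (n.factorial * m.factorial) * (1 / 2) ^ (n + m + 1) := by
  unfold negBinomial
  rw [Nat.cast_choose ℝ (Nat.le_add_left m n), Nat.add_sub_cancel, mul_comm (m.factorial : ℝ)]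

/-- Absorption identity. Multiplying by n raises m, which gives the factorial moments; dividing by n
+ 1 lowers m, which controls the mean of |N - m| / (N + 1). -/
lemma succ_mul_negBinomial_succ (m n : ℕ) :
    ((n : ℝ) + 1) * negBinomial m (n + 1) = (m + 1) * negBinomial (m + 1) n := by
  rw [negBinomial_eq, negBinomial_eq, show n + 1 + m = n + (m + 1) by ring]
  have h1 : ((n + 1).factorial : ℝ) = (n + 1) * n.factorial := by
    rw [Nat.factorial_succ]; push_cast; ring
  have h2 : ((m + 1).factorial : ℝ) = (m + 1) * m.factorial := by
    rw [Nat.factorial_succ]; push_cast; ring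
  rw [h1, h2]
  have := Nat.factorial_pos n
  have := Nat.factorial_pos m
  field_simp

lemma hasSum_negBinomial_mean (m : ℕ) :
    HasSum (fun n : ℕ => (n : ℝ) * negBinomial m n) (m + 1) := by
  rw [← hasSum_nat_add_iff' 1]
  have h := (hasSum_negBinomial (m + 1)).mul_left ((m : ℝ) + 1)
  simp only [Finset.range_one, Finset.sum_singleton, Nat.cast_zero, zero_mul, sub_zero]
  rw [mul_one] at h
  refine h.congr_fun (fun n => ?_)
  rw [← succ_mul_negBinomial_succ]
  push_cast
  ring

lemma hasSum_negBinomial_factorial_moment (m : ℕ) :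
    HasSum (fun n : ℕ => (n : ℝ) * (n - 1) * negBinomial m n) ((m + 1) * (m + 2)) := by
  rw [← hasSum_nat_add_iff' 1]
  have h := (hasSum_negBinomial_mean (m + 1)).mul_left ((m : ℝ) + 1)
  simp only [Finset.range_one, Finset.sum_singleton, Nat.cast_zero, zero_mul, sub_zero]
  rw [show (m : ℝ) + 2 = ((m + 1 : ℕ) : ℝ) + 1 by push_cast; ring]
  refine h.congr_fun (fun n => ?_)
  have := succ_mul_negBinomial_succ m n
  push_cast
  linear_combination (n : ℝ) * this

lemma hasSum_negBinomial_variance (m : ℕ) :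
    HasSum (fun n : ℕ => negBinomial m n * ((n : ℝ) - (m + 1)) ^ 2) (2 * ((m : ℝ) + 1)) := by
  have h := ((hasSum_negBinomial_factorial_moment m).add
    ((hasSum_negBinomial_mean m).mul_left (1 - 2 * ((m : ℝ) + 1)))).add
    ((hasSum_negBinomial m).mul_left (((m : ℝ) + 1) ^ 2))
  convert h using 1
  · funext n; ring
  · ring

/-- AM-GM in place of Cauchy-Schwarz. With s = √(m + 1) and variance 2s², the mean deviation is at
most s/2 + s, whence the 3/2 in `deviationBound`; the extra 1 there pays for unit shifts of the
centre. -/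
lemma abs_le_half_add {s d : ℝ} (hs : 0 < s) : |d| ≤ s / 2 + d ^ 2 * (1 / (2 * s)) := by
  have : s / 2 + d ^ 2 * (1 / (2 * s)) - |d| = (s - |d|) ^ 2 / (2 * s) := by
    rw [← sq_abs d]; field_simp; ring
  have : 0 ≤ (s - |d|) ^ 2 / (2 * s) := by positivity
  linarith

/-- An upper bound for the mean of `|N - (m + 1)| + 1` under `negBinomial m`. -/
noncomputable def deviationBound (m : ℕ) : ℝ := 3 / 2 * √((m : ℝ) + 1) + 1

lemma summable_and_tsum_deviation_le (m : ℕ) :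
    Summable (fun n : ℕ => negBinomial m n * (|(n : ℝ) - (m + 1)| + 1)) ∧
    ∑' n : ℕ, negBinomial m n * (|(n : ℝ) - (m + 1)| + 1) ≤ deviationBound m := by
  have hs : 0 < √((m : ℝ) + 1) := by positivity
  have hss : √((m : ℝ) + 1) * √((m : ℝ) + 1) = m + 1 := Real.mul_self_sqrt (by positivity)
  set s := √((m : ℝ) + 1) with hsdef
  have h := ((hasSum_negBinomial m).mul_left (s / 2 + 1)).add
    ((hasSum_negBinomial_variance m).mul_right (1 / (2 * s)))
  have hle : ∀ n : ℕ, negBinomial m n * (|(n : ℝ) - (m + 1)| + 1) ≤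
      (s / 2 + 1) * negBinomial m n + negBinomial m n * ((n : ℝ) - (m + 1)) ^ 2 * (1 / (2 * s)) := by
    intro n
    have := mul_le_mul_of_nonneg_left (abs_le_half_add (d := (n : ℝ) - (m + 1)) hs)
      (negBinomial_nonneg m n)
    linarith
  have hsum : Summable (fun n : ℕ => negBinomial m n * (|(n : ℝ) - (m + 1)| + 1)) :=
    Summable.of_nonneg_of_le
      (fun n => mul_nonneg (negBinomial_nonneg m n) (by positivity)) hle h.summable
  refine ⟨hsum, (hsum.tsum_le_tsum hle h.summable).trans ?_⟩
  rw [h.tsum_eq, deviationBound, ← hsdef, ← hss]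
  apply le_of_eq
  field_simp
  ring

lemma tendsto_deviationBound_div :
    Tendsto (fun m : ℕ => deviationBound m / (m + 1)) atTop (𝓝 0) := by
  have h1 : Tendsto (fun m : ℕ => (m : ℝ) + 1) atTop atTop :=
    tendsto_atTop_add_const_right _ _ tendsto_natCast_atTop_atTop
  have h2 := (Real.tendsto_sqrt_atTop.comp h1).inv_tendsto_atTop
  have h := (h2.const_mul (3 / 2)).add h1.inv_tendsto_atTop
  rw [mul_zero, add_zero] at h
  refine h.congr (fun m => ?_)
  have hss : √((m : ℝ) + 1) * √((m : ℝ) + 1) = m + 1 := Real.mul_self_sqrt (by positivity)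
  have hs : 0 < √((m : ℝ) + 1) := by positivity
  simp only [Pi.inv_apply, Function.comp, deviationBound]
  rw [add_div, ← hss]
  simp only [Real.sqrt_mul_self hs.le]
  field_simp

/-! ### A slowly varying majorant -/

/-- The majorant for the ratios of the weights `n! / x_n!`. -/
noncomputable def ratioBound (K : ℝ) (n m : ℕ) : ℝ :=
  1 + K * (|(n : ℝ) - m| * (1 / ((n : ℝ) + 1) + 1 / ((m : ℝ) + 1)))

lemma one_le_ratioBound {K : ℝ} (hK : 0 ≤ K) (n m : ℕ) : 1 ≤ ratioBound K n m := by
  unfold ratioBound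
  have : 0 ≤ K * (|(n : ℝ) - m| * (1 / ((n : ℝ) + 1) + 1 / ((m : ℝ) + 1))) := by positivity
  linarith

/-- By symmetry one majorant controls both a ratio of weights and its inverse; the two Jensen bounds
need one each. -/
lemma ratioBound_comm (K : ℝ) (n m : ℕ) : ratioBound K n m = ratioBound K m n := by
  unfold ratioBound
  rw [abs_sub_comm, add_comm (1 / ((n : ℝ) + 1))]

lemma inv_natCast_succ_le_one (n : ℕ) : 1 / ((n : ℝ) + 1) ≤ 1 := by
  rw [div_le_one (by positivity)]
  have : (0 : ℝ) ≤ n := n.cast_nonneg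
  linarith

lemma ratioBound_le {K : ℝ} (hK : 0 ≤ K) (n m : ℕ) :
    ratioBound K n m ≤ 1 + K * (|(n : ℝ) - m| * 2) := by
  unfold ratioBound
  have h1 := inv_natCast_succ_le_one n
  have h2 := inv_natCast_succ_le_one m
  gcongr
  linarith

lemma abs_sub_natCast_le (n m : ℕ) : |(n : ℝ) - m| ≤ |(n : ℝ) - (m + 1)| + 1 := by
  have := abs_add_le ((n : ℝ) - (m + 1)) 1
  rw [abs_one] at this
  rwa [show (n : ℝ) - (m + 1) + 1 = n - m by ring] at this

lemma summable_negBinomial_mul_ratioBound {K : ℝ} (hK : 0 ≤ K) (m : ℕ) :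
    Summable fun n : ℕ => negBinomial m n * ratioBound K n m := by
  refine Summable.of_nonneg_of_le (fun n => mul_nonneg (negBinomial_nonneg m n)
    (zero_le_one.trans (one_le_ratioBound hK n m))) (fun n => ?_)
    ((hasSum_negBinomial m).summable.add
      ((summable_and_tsum_deviation_le m).1.mul_left (2 * K)))
  have h1 := mul_le_mul_of_nonneg_left (ratioBound_le hK n m) (negBinomial_nonneg m n)
  have h2 := mul_le_mul_of_nonneg_left (abs_sub_natCast_le n m)
    (mul_nonneg (negBinomial_nonneg m n) (mul_nonneg zero_le_two hK))
  linarith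

lemma tsum_negBinomial_mul_ratioBound_succ_le {K : ℝ} (hK : 0 ≤ K) (m : ℕ) :
    ∑' n : ℕ, negBinomial (m + 1) n * ratioBound K n (m + 1) ≤
      1 + K * (deviationBound m / (m + 1) + deviationBound (m + 1) / ((m + 1 : ℕ) + 1)) := by
  obtain ⟨s0, t0⟩ := summable_and_tsum_deviation_le m
  obtain ⟨s1, t1⟩ := summable_and_tsum_deviation_le (m + 1)
  have s0' := (summable_nat_add_iff 1).2 s0
  have t0' : ∑' n : ℕ, negBinomial m (n + 1) * (|((n + 1 : ℕ) : ℝ) - (m + 1)| + 1) ≤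
      deviationBound m := by
    refine le_trans ?_ t0
    rw [s0.tsum_eq_zero_add]
    have : 0 ≤ negBinomial m 0 * (|((0 : ℕ) : ℝ) - (m + 1)| + 1) :=
      mul_nonneg (negBinomial_nonneg m 0) (by positivity)
    linarith
  have hb := (hasSum_negBinomial (m + 1)).add
    (((s0'.hasSum.div_const ((m : ℝ) + 1)).add
      (s1.hasSum.div_const (((m + 1 : ℕ) : ℝ) + 1))).mul_left K)
  refine ((summable_negBinomial_mul_ratioBound hK (m + 1)).tsum_le_tsum (fun n => ?_)
    hb.summable).trans ?_
  -- The factor 1/(n+1) is not small for small n; absorbing it into the law with parameter m turns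
  -- it into 1/(m+1). This is why the estimate is stated at m + 1.
  · have e : negBinomial (m + 1) n * (1 / ((n : ℝ) + 1)) = negBinomial m (n + 1) / (m + 1) := by
      have := succ_mul_negBinomial_succ m n
      field_simp
      linarith
    have h1 : negBinomial (m + 1) n * (|(n : ℝ) - (m + 1 : ℕ)| * (1 / ((n : ℝ) + 1))) ≤
        negBinomial m (n + 1) * (|((n + 1 : ℕ) : ℝ) - (m + 1)| + 1) / (m + 1) := by
      have : |(n : ℝ) - (m + 1 : ℕ)| ≤ |((n + 1 : ℕ) : ℝ) - (m + 1)| + 1 := by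
        have := abs_add_le (((n + 1 : ℕ) : ℝ) - (m + 1)) (-1)
        rw [abs_neg, abs_one] at this
        rwa [show ((n + 1 : ℕ) : ℝ) - (m + 1) + -1 = n - (m + 1 : ℕ) by push_cast; ring] at this
      calc _ = negBinomial m (n + 1) / (m + 1) * |(n : ℝ) - (m + 1 : ℕ)| := by rw [← e]; ring
        _ ≤ negBinomial m (n + 1) / (m + 1) * (|((n + 1 : ℕ) : ℝ) - (m + 1)| + 1) :=
          mul_le_mul_of_nonneg_left this
            (div_nonneg (negBinomial_nonneg _ _) (by positivity))
        _ = _ := by ring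
    have h2 : negBinomial (m + 1) n * (|(n : ℝ) - (m + 1 : ℕ)| * (1 / (((m + 1 : ℕ) : ℝ) + 1))) ≤
        negBinomial (m + 1) n * (|(n : ℝ) - ((m + 1 : ℕ) + 1)| + 1) / ((m + 1 : ℕ) + 1) := by
      have := mul_le_mul_of_nonneg_left (abs_sub_natCast_le n (m + 1))
        (div_nonneg (negBinomial_nonneg (m + 1) n) (by positivity : (0 : ℝ) ≤ (m + 1 : ℕ) + 1))
      calc _ = negBinomial (m + 1) n / ((m + 1 : ℕ) + 1) * |(n : ℝ) - (m + 1 : ℕ)| := by ring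
        _ ≤ _ := this
        _ = _ := by ring
    have := mul_le_mul_of_nonneg_left (add_le_add h1 h2) hK
    calc _ = negBinomial (m + 1) n + K *
          (negBinomial (m + 1) n * (|(n : ℝ) - (m + 1 : ℕ)| * (1 / ((n : ℝ) + 1))) +
          negBinomial (m + 1) n * (|(n : ℝ) - (m + 1 : ℕ)| * (1 / (((m + 1 : ℕ) : ℝ) + 1)))) := by
            unfold ratioBound; ring
      _ ≤ _ := by linarith
  · rw [hb.tsum_eq]
    gcongr

lemma one_le_tsum_negBinomial_mul_ratioBound {K : ℝ} (hK : 0 ≤ K) (m : ℕ) :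
    1 ≤ ∑' n : ℕ, negBinomial m n * ratioBound K n m := by
  rw [← (hasSum_negBinomial m).tsum_eq]
  exact (hasSum_negBinomial m).summable.tsum_le_tsum
    (fun n => le_mul_of_one_le_right (negBinomial_nonneg m n) (one_le_ratioBound hK n m))
    (summable_negBinomial_mul_ratioBound hK m)

lemma tendsto_tsum_negBinomial_mul_ratioBound {K : ℝ} (hK : 0 ≤ K) :
    Tendsto (fun m : ℕ => ∑' n : ℕ, negBinomial m n * ratioBound K n m) atTop (𝓝 1) := by
  rw [← tendsto_add_atTop_iff_nat 1]
  have h1 := (tendsto_add_atTop_iff_nat 1).2 tendsto_deviationBound_div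
  have h := ((tendsto_deviationBound_div.add h1).const_mul K).const_add 1
  rw [add_zero, mul_zero, add_zero] at h
  exact tendsto_of_tendsto_of_tendsto_of_le_of_le tendsto_const_nhds h
    (fun m => one_le_tsum_negBinomial_mul_ratioBound hK _)
    (fun m => tsum_negBinomial_mul_ratioBound_succ_le hK m)

/-! ### The Poisson kernel and its integrals -/

/-- The Poisson weight `e⁻ᵗ tⁿ / n!`. -/
noncomputable def poisson (n : ℕ) (t : ℝ) : ℝ := t ^ n / n.factorial * Real.exp (-t)

lemma poisson_nonneg (n : ℕ) {t : ℝ} (ht : 0 ≤ t) : 0 ≤ poisson n t := by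
  unfold poisson; positivity

lemma hasSum_poisson (t : ℝ) : HasSum (fun n => poisson n t) 1 := by
  have h := (NormedSpace.expSeries_div_hasSum_exp t).mul_right (Real.exp (-t))
  rwa [← Real.exp_eq_exp_ℝ, ← Real.exp_add, add_neg_cancel, Real.exp_zero] at h

lemma integral_pow_mul_exp (k : ℕ) {a : ℝ} (ha : 0 < a) :
    ∫ t in Ioi (0 : ℝ), t ^ k * Real.exp (-(a * t)) = (1 / a) ^ (k + 1) * k.factorial := by
  have h := Real.integral_rpow_mul_exp_neg_mul_Ioi (a := (k : ℝ) + 1) (r := a) (by positivity) ha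
  rw [Real.Gamma_nat_eq_factorial] at h
  rw [show ((k : ℝ) + 1) = ((k + 1 : ℕ) : ℝ) by push_cast; rfl, Real.rpow_natCast] at h
  rw [← h]
  refine setIntegral_congr_fun measurableSet_Ioi (fun t _ => ?_)
  rw [show ((k + 1 : ℕ) : ℝ) - 1 = (k : ℝ) by push_cast; ring, Real.rpow_natCast]

lemma integral_poisson (m : ℕ) : ∫ t in Ioi (0 : ℝ), poisson m t = 1 := by
  have h := integral_pow_mul_exp m one_pos
  have : ∀ t, poisson m t = (1 / (m.factorial : ℝ)) * (t ^ m * Real.exp (-(1 * t))) := fun t => by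
    unfold poisson; rw [one_mul]; ring
  simp_rw [this]
  rw [integral_const_mul, h]
  have := Nat.factorial_pos m
  field_simp
  simp

lemma integrableOn_poisson (m : ℕ) : IntegrableOn (poisson m) (Ioi 0) :=
  -- The Bochner integral of a non-integrable function is 0 by convention, so a nonzero value proves
  -- integrability.
  Integrable.of_integral_ne_zero (by rw [integral_poisson]; exact one_ne_zero)

/-- As a function of t, `poisson m` is a Gamma density; mixing Poisson laws over it gives the
negative binomial law. -/
lemma integral_poisson_mul (m n : ℕ) :
    ∫ t in Ioi (0 : ℝ), poisson n t * poisson m t = negBinomial m n := by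
  have h := integral_pow_mul_exp (n + m) two_pos
  have : ∀ t, poisson n t * poisson m t = (1 / ((n.factorial : ℝ) * m.factorial)) *
      (t ^ (n + m) * Real.exp (-(2 * t))) := fun t => by
    unfold poisson
    rw [show -(2 * t) = -t + -t by ring, Real.exp_add, pow_add]; ring
  simp_rw [this]
  rw [integral_const_mul, h, negBinomial_eq]
  ring

lemma integrableOn_poisson_mul (m n : ℕ) :
    IntegrableOn (fun t => poisson n t * poisson m t) (Ioi 0) := by
  refine Integrable.of_integral_ne_zero ?_
  rw [integral_poisson_mul]
  unfold negBinomial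
  have := Nat.choose_pos (Nat.le_add_left m n)
  positivity

/-- The mean of the majorant `ratioBound` over a Poisson variable. -/
noncomputable def poissonMajorant (K : ℝ) (m : ℕ) (t : ℝ) : ℝ :=
  ∑' n : ℕ, ratioBound K n m * (poisson n t * poisson m t)

lemma integral_poissonMajorant {K : ℝ} (hK : 0 ≤ K) (m : ℕ) :
    ∫ t in Ioi (0 : ℝ), poissonMajorant K m t = ∑' n : ℕ, negBinomial m n * ratioBound K n m := by
  have hI : ∀ n : ℕ, ∫ t in Ioi (0 : ℝ), ratioBound K n m * (poisson n t * poisson m t) =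
      negBinomial m n * ratioBound K n m := fun n => by
    rw [integral_const_mul, integral_poisson_mul, mul_comm]
  have hN : ∀ n : ℕ, ∫ t in Ioi (0 : ℝ), ‖ratioBound K n m * (poisson n t * poisson m t)‖ =
      negBinomial m n * ratioBound K n m := fun n => by
    rw [← hI]
    refine setIntegral_congr_fun measurableSet_Ioi (fun t ht => ?_)
    have ht' : (0 : ℝ) ≤ t := le_of_lt ht
    exact Real.norm_of_nonneg (mul_nonneg (zero_le_one.trans (one_le_ratioBound hK n m))
      (mul_nonneg (poisson_nonneg n ht') (poisson_nonneg m ht')))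
  have h := integral_tsum_of_summable_integral_norm
    (F := fun n t => ratioBound K n m * (poisson n t * poisson m t))
    (μ := volume.restrict (Ioi (0 : ℝ)))
    (fun n => (integrableOn_poisson_mul m n).const_mul _)
    (by simp_rw [hN]; exact summable_negBinomial_mul_ratioBound hK m)
  simp_rw [hI] at h
  exact h.symm

lemma integrableOn_poissonMajorant {K : ℝ} (hK : 0 ≤ K) (m : ℕ) :
    IntegrableOn (poissonMajorant K m) (Ioi 0) := by
  refine Integrable.of_integral_ne_zero ?_
  rw [integral_poissonMajorant hK]
  exact (zero_lt_one.trans_le (one_le_tsum_negBinomial_mul_ratioBound hK m)).ne'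

/-- The majorant grows at most linearly in n, and n + 1 ≤ 2^n reduces the series to the exponential
series at 2t. -/
lemma summable_poissonMajorant {K : ℝ} (hK : 0 ≤ K) (m : ℕ) {t : ℝ} (ht : 0 ≤ t) :
    Summable fun n : ℕ => ratioBound K n m * poisson n t := by
  have h1 := (Real.summable_pow_div_factorial (2 * t)).mul_left
    ((1 + 2 * K * (1 + m)) * Real.exp (-t))
  refine Summable.of_nonneg_of_le (fun n => mul_nonneg
    (zero_le_one.trans (one_le_ratioBound hK n m)) (poisson_nonneg n ht)) (fun n => ?_) h1
  have h2 : (n : ℝ) + 1 ≤ 2 ^ n := by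
    have := Nat.lt_two_pow_self (n := n)
    exact_mod_cast this
  have hn : (0 : ℝ) ≤ n := n.cast_nonneg
  have hm : (0 : ℝ) ≤ m := m.cast_nonneg
  have h3 : |(n : ℝ) - m| ≤ n + m := by
    rw [abs_le]; constructor <;> linarith
  have h4 : ratioBound K n m ≤ (1 + 2 * K * (1 + m)) * 2 ^ n := by
    calc ratioBound K n m ≤ 1 + K * (|(n : ℝ) - m| * 2) := ratioBound_le hK n m
      _ ≤ 1 + K * ((n + m) * 2) := by gcongr
      _ ≤ (1 + 2 * K * (1 + m)) * (n + 1) := by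
        nlinarith [mul_nonneg hK hn, mul_nonneg hK (mul_nonneg hm hn)]
      _ ≤ _ := by gcongr
  calc _ ≤ (1 + 2 * K * (1 + m)) * 2 ^ n * poisson n t :=
        mul_le_mul_of_nonneg_right h4 (poisson_nonneg n ht)
    _ = _ := by unfold poisson; rw [mul_pow]; ring

/-! ### Weights of a perturbation -/

/-- A sequence with `x n ∈ (n - 1, n + 1)` for `n ≥ 1` whose first term is at least `r > 0`. -/
structure IsBracketed (r : ℝ) (x : ℕ → ℝ) : Prop where
  pos : 0 < r
  le_first : r ≤ x 1
  lower : ∀ n : ℕ, (n : ℝ) < x (n + 1)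
  upper : ∀ n : ℕ, x (n + 1) < n + 2

/-- The ratio of the factorials `n!` and `x_n!`. -/
noncomputable def weight (x : ℕ → ℝ) (n : ℕ) : ℝ := n.factorial / seqFactorial x n

lemma seqFactorial_succ (x : ℕ → ℝ) (n : ℕ) :
    seqFactorial x (n + 1) = seqFactorial x n * x (n + 1) := by
  unfold seqFactorial; rw [Finset.prod_range_succ]

lemma weight_zero (x : ℕ → ℝ) : weight x 0 = 1 := by
  simp [weight, seqFactorial]

lemma weight_succ (x : ℕ → ℝ) (n : ℕ) :
    weight x (n + 1) = weight x n * (((n : ℝ) + 1) / x (n + 1)) := by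
  unfold weight
  rw [seqFactorial_succ, Nat.factorial_succ]
  push_cast
  rw [div_mul_div_comm, mul_comm ((n : ℝ) + 1)]

namespace IsBracketed

variable {r : ℝ} {x : ℕ → ℝ} (h : IsBracketed r x)
include h

lemma term_pos (n : ℕ) : 0 < x (n + 1) := (Nat.cast_nonneg n).trans_lt (h.lower n)

lemma seqFactorial_pos (n : ℕ) : 0 < seqFactorial x n :=
  Finset.prod_pos fun k _ => h.term_pos k

lemma weight_pos (n : ℕ) : 0 < weight x n :=
  div_pos (by positivity) (h.seqFactorial_pos n)

/-- Monotonicity of w_n / n, from w_{n+1} / w_n = (n + 1) / x_{n+1} ≤ (n + 1) / n. At m = 0 it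
carries no information. -/
lemma weight_mul_le {m n : ℕ} (hmn : m ≤ n) : weight x n * m ≤ n * weight x m := by
  induction n, hmn using Nat.le_induction with
  | base => rw [mul_comm]
  | succ n _ ih =>
    have hx := h.term_pos n
    have hq : 0 ≤ ((n : ℝ) + 1) / x (n + 1) := by positivity
    have h1 : (n : ℝ) * (((n : ℝ) + 1) / x (n + 1)) ≤ n + 1 := by
      rw [mul_div_assoc', div_le_iff₀ hx, mul_comm (n : ℝ)]
      exact mul_le_mul_of_nonneg_left (h.lower n).le (by positivity)
    rw [weight_succ]
    calc weight x n * (((n : ℝ) + 1) / x (n + 1)) * m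
        = weight x n * m * (((n : ℝ) + 1) / x (n + 1)) := by ring
      _ ≤ n * weight x m * (((n : ℝ) + 1) / x (n + 1)) := mul_le_mul_of_nonneg_right ih hq
      _ = n * (((n : ℝ) + 1) / x (n + 1)) * weight x m := by ring
      _ ≤ (n + 1) * weight x m := mul_le_mul_of_nonneg_right h1 (h.weight_pos m).le
      _ = _ := by push_cast; ring

lemma weight_mul_succ_le {m n : ℕ} (hmn : m ≤ n) :
    weight x m * (m + 1) ≤ weight x n * (n + 1) := by
  induction n, hmn using Nat.le_induction with
  | base => exact le_rfl
  | succ n _ ih =>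
    refine ih.trans ?_
    rw [weight_succ, mul_assoc]
    refine mul_le_mul_of_nonneg_left ?_ (h.weight_pos n).le
    have hx := h.term_pos n
    rw [div_mul_eq_mul_div, le_div_iff₀ hx]
    refine mul_le_mul_of_nonneg_left ?_ (by positivity)
    have := (h.upper n).le
    push_cast
    linarith

lemma weight_one_le : weight x 1 ≤ 1 / r := by
  rw [show (1 : ℕ) = 0 + 1 from rfl, weight_succ, weight_zero]
  have := one_div_le_one_div_of_le h.pos h.le_first
  simpa using this

lemma weight_le (n m : ℕ) : weight x n ≤ ratioBound (2 / r + 2) n m * weight x m := by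
  have hwm := h.weight_pos m
  have hr := h.pos
  have hK : 0 < 2 / r := by positivity
  rcases le_or_gt n m with hnm | hnm
  · have h1 := h.weight_mul_succ_le hnm
    have hc : (n : ℝ) ≤ m := by exact_mod_cast hnm
    have h2 : weight x n ≤ (1 + ((m : ℝ) - n) * (1 / ((n : ℝ) + 1))) * weight x m := by
      have : (1 + ((m : ℝ) - n) * (1 / ((n : ℝ) + 1))) * weight x m =
          weight x m * (m + 1) / (n + 1) := by field_simp; ring
      rw [this, le_div_iff₀ (by positivity)]
      exact h1
    refine h2.trans (mul_le_mul_of_nonneg_right ?_ hwm.le)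
    unfold ratioBound
    rw [abs_sub_comm, abs_of_nonneg (sub_nonneg.2 hc)]
    have hd : 0 ≤ (m : ℝ) - n := sub_nonneg.2 hc
    have ha : 0 ≤ ((m : ℝ) - n) * (1 / ((n : ℝ) + 1)) := by positivity
    have hb : 0 ≤ ((m : ℝ) - n) * (1 / ((m : ℝ) + 1)) := by positivity
    nlinarith [mul_nonneg hK.le ha, mul_nonneg hK.le hb]
  · have h1 := h.weight_mul_le hnm.le
    have hc : (m : ℝ) ≤ n := by exact_mod_cast hnm.le
    have hd : 0 ≤ (n : ℝ) - m := sub_nonneg.2 hc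
    have ha : 0 ≤ ((n : ℝ) - m) * (1 / ((n : ℝ) + 1)) := by positivity
    have hb : 0 ≤ ((n : ℝ) - m) * (1 / ((m : ℝ) + 1)) := by positivity
    -- For m = 0 the comparison starts at index 1, with w_1 ≤ 1/r: this is the role of 2/r in the
    -- constant. For m ≥ 1 the bound 1/m ≤ 2/(m+1) accounts for the summand 2.
    rcases Nat.eq_zero_or_pos m with rfl | hm
    · have h3 := h.weight_mul_le (show 1 ≤ n from hnm)
      have h4 := mul_le_mul_of_nonneg_left h.weight_one_le (Nat.cast_nonneg (α := ℝ) n)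
      unfold ratioBound
      rw [abs_of_nonneg hd, weight_zero]
      have hn : (0 : ℝ) ≤ n := n.cast_nonneg
      have hrn : 0 ≤ n * (1 / r) := by positivity
      have : 2 / r = 2 * (1 / r) := by ring
      simp only [Nat.cast_zero, sub_zero, zero_add, div_one, Nat.cast_one, mul_one] at *
      have : 0 ≤ (2 / r + 2) * (n * (1 / ((n : ℝ) + 1))) := by positivity
      nlinarith
    · have hmr : (1 : ℝ) ≤ m := by exact_mod_cast hm
      have h2 : weight x n ≤ (1 + 2 * (((n : ℝ) - m) * (1 / ((m : ℝ) + 1)))) * weight x m := by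
        have h3 : weight x n ≤ (1 + ((n : ℝ) - m) * (1 / m)) * weight x m := by
          have : (1 + ((n : ℝ) - m) * (1 / m)) * weight x m = n * weight x m / m := by
            field_simp; ring
          rw [this, le_div_iff₀ (by positivity)]
          exact h1
        refine h3.trans (mul_le_mul_of_nonneg_right ?_ hwm.le)
        have : 1 / (m : ℝ) ≤ 2 * (1 / ((m : ℝ) + 1)) := by
          rw [mul_one_div, div_le_div_iff₀ (by positivity) (by positivity)]
          linarith
        nlinarith [mul_le_mul_of_nonneg_left this hd]
      refine h2.trans (mul_le_mul_of_nonneg_right ?_ hwm.le)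
      unfold ratioBound
      rw [abs_of_nonneg hd]
      nlinarith [mul_nonneg hK.le ha, mul_nonneg hK.le hb]

lemma pow_div_seqFactorial (n : ℕ) (t : ℝ) :
    t ^ n / seqFactorial x n = Real.exp t * (weight x n * poisson n t) := by
  have := h.seqFactorial_pos n
  unfold weight poisson
  rw [Real.exp_neg]
  have := Nat.factorial_pos n
  have := Real.exp_pos t
  field_simp

lemma summable_weight_mul_poisson {t : ℝ} (ht : 0 ≤ t) :
    Summable fun n : ℕ => weight x n * poisson n t := by
  have hK : 0 ≤ 2 / r + 2 := by have := h.pos; positivity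
  refine Summable.of_nonneg_of_le (fun n => mul_nonneg (h.weight_pos n).le (poisson_nonneg n ht))
    (fun n => ?_) (summable_poissonMajorant hK 0 ht)
  have := h.weight_le n 0
  rw [weight_zero, mul_one] at this
  exact mul_le_mul_of_nonneg_right this (poisson_nonneg n ht)

lemma summable_pow_div_seqFactorial (t : ℝ) : Summable fun n : ℕ => t ^ n / seqFactorial x n := by
  have h1 := (h.summable_weight_mul_poisson (abs_nonneg t)).mul_left (Real.exp |t|)
  simp_rw [← h.pow_div_seqFactorial] at h1
  refine Summable.of_norm (h1.congr fun n => ?_)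
  rw [norm_div, norm_pow, Real.norm_eq_abs, Real.norm_of_nonneg (h.seqFactorial_pos n).le]

/-- Pointwise bounds for the integrand of the moment ratio, by Jensen's inequality for `u ↦ 1 / u`
and a Poisson variable. -/
lemma integrand_bounds (m : ℕ) {t : ℝ} (ht : 0 ≤ t) :
    2 * poisson m t - poissonMajorant (2 / r + 2) m t ≤
      (t ^ m / seqFactorial x m) / ∑' n : ℕ, t ^ n / seqFactorial x n ∧
    (t ^ m / seqFactorial x m) / ∑' n : ℕ, t ^ n / seqFactorial x n ≤
      poissonMajorant (2 / r + 2) m t := by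
  have hK : 0 ≤ 2 / r + 2 := by have := h.pos; positivity
  set K := 2 / r + 2 with hKdef
  have hQs := summable_poissonMajorant hK m ht
  have hEs := h.summable_weight_mul_poisson ht
  have hps := hasSum_poisson t
  have hpm := poisson_nonneg m ht
  have hwm := h.weight_pos m
  simp_rw [h.pow_div_seqFactorial]
  rw [tsum_mul_left, mul_div_mul_left _ _ (Real.exp_pos t).ne']
  have hH : poissonMajorant K m t = (∑' n : ℕ, ratioBound K n m * poisson n t) * poisson m t := by
    unfold poissonMajorant
    rw [← tsum_mul_right]
    exact tsum_congr fun n => by ring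
  have hE : 0 < ∑' n : ℕ, weight x n * poisson n t := by
    refine hEs.tsum_pos (fun n => mul_nonneg (h.weight_pos n).le (poisson_nonneg n ht)) 0 ?_
    rw [weight_zero]
    unfold poisson
    simp [Real.exp_pos]
  have h1 : ∑' n : ℕ, weight x n * poisson n t ≤
      weight x m * ∑' n : ℕ, ratioBound K n m * poisson n t := by
    rw [← tsum_mul_left]
    refine hEs.tsum_le_tsum (fun n => ?_) (hQs.mul_left _)
    have := mul_le_mul_of_nonneg_right (h.weight_le n m) (poisson_nonneg n ht)
    linarith
  have h2 : weight x m / ∑' n : ℕ, weight x n * poisson n t ≤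
      ∑' n : ℕ, ratioBound K n m * poisson n t := by
    -- Jensen by the tangent line of 1/u at u = E: it equals 2/E - u/E², lies below 1/u, and has
    -- Poisson mean 1/E at u = w_N.
    set E := ∑' n : ℕ, weight x n * poisson n t with hEdef
    have hs := ((hps.mul_left (2 / E)).sub (hEs.hasSum.mul_left ((1 / E) ^ 2))).mul_left
      (weight x m)
    have hv : weight x m * (2 / E * 1 - (1 / E) ^ 2 * E) = weight x m / E := by
      field_simp; ring
    rw [← hEdef, hv] at hs
    rw [← hs.tsum_eq]
    refine hs.summable.tsum_le_tsum (fun n => ?_) hQs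
    have hwn := h.weight_pos n
    have h3 : 2 / E - (1 / E) ^ 2 * weight x n ≤ 1 / weight x n := by
      have : 1 / weight x n - (2 / E - (1 / E) ^ 2 * weight x n) =
          (E - weight x n) ^ 2 / (E ^ 2 * weight x n) := by
        field_simp
        ring
      have : 0 ≤ (E - weight x n) ^ 2 / (E ^ 2 * weight x n) := by positivity
      linarith
    have h4 : weight x m * (1 / weight x n) ≤ ratioBound K n m := by
      rw [mul_one_div, div_le_iff₀ hwn, ratioBound_comm]
      exact h.weight_le m n
    calc _ = weight x m * (2 / E - (1 / E) ^ 2 * weight x n) * poisson n t := by ring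
      _ ≤ ratioBound K n m * poisson n t := mul_le_mul_of_nonneg_right
        ((mul_le_mul_of_nonneg_left h3 hwm.le).trans h4) (poisson_nonneg n ht)
  rw [hH]
  set E := ∑' n : ℕ, weight x n * poisson n t
  set Q := ∑' n : ℕ, ratioBound K n m * poisson n t
  rw [mul_div_right_comm]
  refine ⟨?_, mul_le_mul_of_nonneg_right h2 hpm⟩
  rw [← sub_mul]
  refine mul_le_mul_of_nonneg_right ?_ hpm
  -- Lower bound from y + 1/y ≥ 2 with y = w_m / E, where 1/y ≤ Q.
  have h5 : E / weight x m ≤ Q := by rw [div_le_iff₀ hwm]; linarith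
  have h6 : 2 ≤ weight x m / E + E / weight x m := by
    have : weight x m / E + E / weight x m - 2 = (weight x m - E) ^ 2 / (E * weight x m) := by
      field_simp
      ring
    have : 0 ≤ (weight x m - E) ^ 2 / (E * weight x m) := by positivity
    linarith
  linarith

lemma integrableOn_integrand (m : ℕ) :
    IntegrableOn (fun t : ℝ => (t ^ m / seqFactorial x m) /
      ∑' n : ℕ, t ^ n / seqFactorial x n) (Ioi 0) := by
  have hK : 0 ≤ 2 / r + 2 := by have := h.pos; positivity
  refine Integrable.mono' (integrableOn_poissonMajorant hK m) ?_ ?_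
  · have hm : Measurable fun t : ℝ => ∑' n : ℕ, t ^ n / seqFactorial x n :=
      measurable_of_tendsto_metrizable
        (f := fun N t => ∑ n ∈ Finset.range N, t ^ n / seqFactorial x n)
        (fun N => by fun_prop)
        (tendsto_pi_nhds.2 fun t => (h.summable_pow_div_seqFactorial t).hasSum.tendsto_sum_nat)
    exact (((measurable_id.pow_const m).div_const _).div hm).aestronglyMeasurable
  · refine (ae_restrict_mem measurableSet_Ioi).mono fun t ht => ?_
    have ht' : (0 : ℝ) ≤ t := le_of_lt ht
    rw [Real.norm_of_nonneg]
    · exact (h.integrand_bounds m ht').2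
    · exact div_nonneg (div_nonneg (pow_nonneg ht' m) (h.seqFactorial_pos m).le)
        (tsum_nonneg fun n => div_nonneg (pow_nonneg ht' n) (h.seqFactorial_pos n).le)

lemma tendsto_integral :
    Tendsto (fun m : ℕ => ∫ t in Ioi (0 : ℝ), (t ^ m / seqFactorial x m) /
      ∑' n : ℕ, t ^ n / seqFactorial x n) atTop (𝓝 1) := by
  have hK : 0 ≤ 2 / r + 2 := by have := h.pos; positivity
  have hS := tendsto_tsum_negBinomial_mul_ratioBound hK
  have hS' := hS.const_sub 2
  rw [show (2 : ℝ) - 1 = 1 by norm_num] at hS'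
  refine tendsto_of_tendsto_of_tendsto_of_le_of_le hS' hS (fun m => ?_) (fun m => ?_)
  · have h1 : ∫ t in Ioi (0 : ℝ), (2 * poisson m t - poissonMajorant (2 / r + 2) m t) =
        2 - ∑' n : ℕ, negBinomial m n * ratioBound (2 / r + 2) n m := by
      rw [integral_sub ((integrableOn_poisson m).const_mul 2) (integrableOn_poissonMajorant hK m),
        integral_const_mul, integral_poisson, integral_poissonMajorant hK, mul_one]
    simp only
    rw [← h1]
    exact setIntegral_mono_on
      (((integrableOn_poisson m).const_mul 2).sub (integrableOn_poissonMajorant hK m))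
      (h.integrableOn_integrand m) measurableSet_Ioi
      fun t ht => (h.integrand_bounds m (le_of_lt ht)).1
  · simp only
    rw [← integral_poissonMajorant hK]
    exact setIntegral_mono_on (h.integrableOn_integrand m) (integrableOn_poissonMajorant hK m)
      measurableSet_Ioi fun t ht => (h.integrand_bounds m (le_of_lt ht)).2

lemma tendsto_momentRatio : Tendsto (momentRatio x) atTop (𝓝 1) := by
  refine h.tendsto_integral.congr fun m => ?_
  unfold momentRatio seqExp
  rw [← integral_div]
  refine setIntegral_congr_fun measurableSet_Ioi fun t _ => ?_
  exact div_right_comm _ _ _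

lemma tendsto_renormalized_div :
    Tendsto (fun n : ℕ => renormalized x n / x n) atTop (𝓝 1) := by
  rw [← tendsto_add_atTop_iff_nat 1]
  have h1 := ((tendsto_add_atTop_iff_nat 1).2 h.tendsto_momentRatio).div
    h.tendsto_momentRatio one_ne_zero
  rw [div_one] at h1
  refine h1.congr fun n => ?_
  have := (h.term_pos n).ne'
  simp only [renormalized, Pi.div_apply]
  field_simp

end IsBracketed

lemma IsAlphaPerturbation.exists_isBracketed {α x : ℕ → ℝ} (hα : IsAlphaPerturbation α)
    (hx : ∀ n : ℕ, x n = n + α n) : ∃ r, IsBracketed r x := by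
  obtain ⟨r, hr, hj⟩ := hα.jumps
  refine ⟨r, hr.1, ?_, fun n => ?_, fun n => ?_⟩
  -- The jump at 0, where α vanishes, keeps x_1 ≥ r; the bracket alone would only give x_1 > 0.
  · have h0 := hj 0
    rw [hα.zero, zero_add] at h0
    rw [hx, Nat.cast_one]
    linarith
  · rw [hx]
    have := (hα.mem_Ioo (n + 1)).1
    push_cast
    linarith
  · rw [hx]
    have := (hα.mem_Ioo (n + 1)).2
    push_cast
    linarith

/-! ### Piecewise linear extensions -/

/-- The piecewise linear interpolation of `α` on `[0, ∞)`. -/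
noncomputable def linearInterpolation (α : ℕ → ℝ) (y : ℝ) : ℝ :=
  α ⌊y⌋₊ + (y - ⌊y⌋₊) * (α (⌊y⌋₊ + 1) - α ⌊y⌋₊)

lemma hasDerivAt_linearInterpolation (α : ℕ → ℝ) {k : ℕ} {y : ℝ} (hy : y ∈ Ioo (k : ℝ) (k + 1)) :
    HasDerivAt (linearInterpolation α) (α (k + 1) - α k) y := by
  have h : HasDerivAt (fun y : ℝ => α k + (y - k) * (α (k + 1) - α k)) (α (k + 1) - α k) y := by
    simpa using (((hasDerivAt_id y).sub_const (k : ℝ)).mul_const (α (k + 1) - α k)).const_add (α k)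
  refine h.congr_of_eventuallyEq ?_
  filter_upwards [Ioo_mem_nhds hy.1 hy.2] with z hz
  have : ⌊z⌋₊ = k := (Nat.floor_eq_iff ((Nat.cast_nonneg k).trans hz.1.le)).2 ⟨hz.1.le, hz.2⟩
  simp only [linearInterpolation, this]

lemma hasDerivAt_deriv_linearInterpolation (α : ℕ → ℝ) {k : ℕ} {y : ℝ}
    (hy : y ∈ Ioo (k : ℝ) (k + 1)) : HasDerivAt (deriv (linearInterpolation α)) 0 y := by
  refine (hasDerivAt_const y (α (k + 1) - α k)).congr_of_eventuallyEq ?_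
  filter_upwards [Ioo_mem_nhds hy.1 hy.2] with z hz
  exact (hasDerivAt_linearInterpolation α hz).deriv

lemma secondDeriv_linearInterpolation (α : ℕ → ℝ) {k : ℕ} {y : ℝ}
    (hy : y ∈ Ioo (k : ℝ) (k + 1)) : secondDeriv (linearInterpolation α) y = 0 := by
  have : derivDomain (linearInterpolation α) ∈ 𝓝 y := by
    filter_upwards [Ioo_mem_nhds hy.1 hy.2] with z hz
    exact (hasDerivAt_linearInterpolation α hz).differentiableAt
  unfold secondDeriv
  rw [derivWithin_of_mem_nhds this]
  exact (hasDerivAt_deriv_linearInterpolation α hy).deriv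

lemma ae_exists_mem_Ioo_natCast : ∀ᵐ y : ℝ, 0 < y → ∃ k : ℕ, y ∈ Ioo (k : ℝ) (k + 1) := by
  have h : ∀ᵐ y : ℝ, y ∉ range ((↑) : ℕ → ℝ) := (countable_range _).ae_notMem volume
  filter_upwards [h] with y hy hy0
  refine ⟨⌊y⌋₊, (Nat.floor_le hy0.le).lt_of_ne fun e => hy ⟨_, e⟩, Nat.lt_floor_add_one y⟩

/-- Off the integers, a null set, the slope is a difference of two numbers in (-1, 1) and the second
derivative is 0. -/
lemma isMildExtension_linearInterpolation {α : ℕ → ℝ} (hα : ∀ n, α n ∈ Ioo (-1 : ℝ) 1) :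
    IsMildExtension α (linearInterpolation α) where
  extend n := by simp [linearInterpolation]
  twice_differentiable := by
    rw [ae_restrict_iff' measurableSet_Ioi]
    filter_upwards [ae_exists_mem_Ioo_natCast] with y hy hy0
    obtain ⟨k, hk⟩ := hy hy0
    exact ⟨(hasDerivAt_linearInterpolation α hk).differentiableAt,
      (hasDerivAt_deriv_linearInterpolation α hk).differentiableAt.differentiableWithinAt⟩
  deriv_bound := by
    refine ⟨2, 1, ?_⟩
    filter_upwards [ae_exists_mem_Ioo_natCast] with y hy hy0
    obtain ⟨k, hk⟩ := hy (by linarith)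
    rw [(hasDerivAt_linearInterpolation α hk).deriv, abs_le]
    have h1 := hα k
    have h2 := hα (k + 1)
    constructor <;> linarith [h1.1, h1.2, h2.1, h2.2]
  secondDeriv_bound := by
    refine ⟨0, 1, ?_⟩
    filter_upwards [ae_exists_mem_Ioo_natCast] with y hy hy0
    obtain ⟨k, hk⟩ := hy (by linarith)
    rw [secondDeriv_linearInterpolation α hk, abs_zero, mul_zero]

/-! ### Sequences with two gaps -/

/-- The sequence `n - δ ⌊(n + e) / θ⌋`, whose gaps are `1` and `1 - δ`. -/
noncomputable def twoGapSeq (δ θ e : ℝ) (n : ℕ) : ℝ := n - δ * ⌊((n : ℝ) + e) / θ⌋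

section TwoGapSeq

variable {δ θ e : ℝ}

lemma twoGapSeq_gap (hδ : 0 < δ) (hθ : 1 < θ) (n : ℕ) :
    1 - δ ≤ twoGapSeq δ θ e (n + 1) - twoGapSeq δ θ e n := by
  have h : ⌊(((n + 1 : ℕ) : ℝ) + e) / θ⌋ ≤ ⌊((n : ℝ) + e) / θ⌋ + 1 := by
    rw [← Int.floor_add_one]
    refine Int.floor_mono ?_
    have : 1 / θ ≤ 1 := by rw [div_le_one (by linarith)]; exact hθ.le
    calc (((n + 1 : ℕ) : ℝ) + e) / θ = ((n : ℝ) + e) / θ + 1 / θ := by push_cast; ring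
      _ ≤ _ := by linarith
  have h' : (⌊(((n + 1 : ℕ) : ℝ) + e) / θ⌋ : ℝ) ≤ ⌊((n : ℝ) + e) / θ⌋ + 1 := by exact_mod_cast h
  have := mul_le_mul_of_nonneg_left h' hδ.le
  unfold twoGapSeq
  push_cast at *
  linarith

lemma strictMono_twoGapSeq (hδ : 0 < δ) (hδ1 : δ < 1) (hθ : 1 < θ) :
    StrictMono (twoGapSeq δ θ e) :=
  strictMono_nat_of_lt_succ fun n => by
    have := twoGapSeq_gap (e := e) hδ hθ n
    linarith

lemma twoGapSeq_zero (hθ : 1 < θ) (he : 0 ≤ e) (heθ : e < θ) : twoGapSeq δ θ e 0 = 0 := by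
  have : ⌊(((0 : ℕ) : ℝ) + e) / θ⌋ = 0 := by
    rw [Int.floor_eq_zero_iff, Nat.cast_zero, zero_add]
    exact ⟨by positivity, (div_lt_one (by linarith)).2 heθ⟩
  rw [twoGapSeq, this]
  simp

/-- The sawtooth form of the deviation yields both the density and the bounds on α. -/
lemma twoGapSeq_sub (n : ℕ) : twoGapSeq δ θ e n - (1 - δ / θ) * n =
    δ * (Int.fract (((n : ℝ) + e) / θ) - e / θ) := by
  rw [twoGapSeq, Int.fract]
  ring

lemma two_gap_density_pos (hδ : 0 < δ) (hδ1 : δ < 1) (hθ : 1 < θ) : 0 < 1 - δ / θ := by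
  have : δ / θ < δ := div_lt_self hδ hθ
  linarith

lemma tendsto_twoGapSeq_div (hδ : 0 < δ) (hθ : 1 < θ) (he : 0 ≤ e) :
    Tendsto (fun n : ℕ => twoGapSeq δ θ e n / n) atTop (𝓝 (1 - δ / θ)) := by
  have h0 : Tendsto (fun n : ℕ => (δ * (Int.fract (((n : ℝ) + e) / θ) - e / θ)) / n)
      atTop (𝓝 0) := by
    refine squeeze_zero_norm (a := fun n : ℕ => δ * (1 + e / θ) / n) (fun n => ?_)
      (tendsto_const_div_atTop_nhds_zero_nat _)
    have h1 := Int.fract_nonneg (((n : ℝ) + e) / θ)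
    have h2 := (Int.fract_lt_one (((n : ℝ) + e) / θ)).le
    have h3 : 0 ≤ e / θ := by positivity
    rw [norm_div, norm_mul, Real.norm_of_nonneg hδ.le, Real.norm_eq_abs, Real.norm_natCast]
    gcongr
    rw [abs_le]
    constructor <;> linarith
  have h1 := h0.add_const (1 - δ / θ)
  rw [zero_add] at h1
  refine h1.congr' ?_
  filter_upwards [eventually_ge_atTop 1] with n hn
  have hn' : (n : ℝ) ≠ 0 := by positivity
  rw [← twoGapSeq_sub]
  field_simp
  ring

lemma isAlphaPerturbation_twoGapSeq (hδ : 0 < δ) (hδ1 : δ < 1) (hθ : 1 < θ) (he : 0 ≤ e)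
    (heθ : e < θ) (hlo : δ * (e / θ) < 1 - δ / θ) (hhi : δ * (1 - e / θ) ≤ 1 - δ / θ) :
    IsAlphaPerturbation fun n : ℕ => twoGapSeq δ θ e n / (1 - δ / θ) - n := by
  have hc := two_gap_density_pos hδ hδ1 hθ
  -- The constant r is the short gap divided by the mean gap.
  refine ⟨by simp [twoGapSeq_zero hθ he heθ], fun n => ?_, (1 - δ) / (1 - δ / θ), ?_, fun n => ?_⟩
  · have e1 : twoGapSeq δ θ e n / (1 - δ / θ) - n =
        δ * (Int.fract (((n : ℝ) + e) / θ) - e / θ) / (1 - δ / θ) := by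
      rw [← twoGapSeq_sub]
      generalize 1 - δ / θ = c at hc
      field_simp
    have h1 := Int.fract_nonneg (((n : ℝ) + e) / θ)
    have h2 := Int.fract_lt_one (((n : ℝ) + e) / θ)
    simp only [e1]
    constructor
    · rw [lt_div_iff₀ hc]
      nlinarith [mul_nonneg hδ.le h1]
    · rw [div_lt_one hc]
      nlinarith [mul_lt_mul_of_pos_left h2 hδ]
  · refine ⟨div_pos (by linarith) hc, ?_⟩
    rw [div_lt_one hc]
    have := div_lt_self hδ hθ
    linarith
  · have h1 := div_le_div_of_nonneg_right (twoGapSeq_gap (e := e) hδ hθ n) hc.le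
    rw [sub_div (twoGapSeq δ θ e (n + 1))] at h1
    push_cast
    linarith

end TwoGapSeq

/-! ### The greedy algorithm and its integer parts -/

/-- Induction on k: subtracting the greedy remainder from x leaves the largest element of W below x.
The gap (0, 1) in W is the base case, and `hstep` passes from x / β to x. -/
lemma greedy_remainder {β : ℝ} (hβ : 1 < β) {W : Set ℝ} (h0 : 0 ∈ W) (h1 : ∀ w ∈ W, w ≤ 0 ∨ 1 ≤ w)
    (hstep : ∀ g ∈ W, ∀ y, g ≤ y → y < g + 1 → (∀ w ∈ W, w ≤ g ∨ y < w) →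
      β * g + ⌊β * (y - g)⌋ ∈ W ∧ ∀ w ∈ W, w ≤ β * g + ⌊β * (y - g)⌋ ∨ β * y < w)
    (k : ℕ) : ∀ x : ℝ, 0 ≤ x → x < β ^ k →
      0 ≤ (greedyStep β)^[k] (x / β ^ k) ∧ (greedyStep β)^[k] (x / β ^ k) < 1 ∧
      x - (greedyStep β)^[k] (x / β ^ k) ∈ W ∧
      ∀ w ∈ W, w ≤ x - (greedyStep β)^[k] (x / β ^ k) ∨ x < w := by
  induction k with
  | zero =>
    intro x hx hx1
    simp only [pow_zero, div_one, Function.iterate_zero, id, sub_self] at *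
    exact ⟨hx, hx1, h0, fun w hw => (h1 w hw).imp_right hx1.trans_le⟩
  | succ k ih =>
    intro x hx hx1
    have hβ0 : 0 < β := by linarith
    obtain ⟨z0, z1, zW, zn⟩ := ih (x / β) (by positivity)
      (by rw [div_lt_iff₀ hβ0, ← pow_succ]; exact hx1)
    rw [Function.iterate_succ_apply', show x / β ^ (k + 1) = x / β / β ^ k by
      rw [div_div, pow_succ']]
    set z := (greedyStep β)^[k] (x / β / β ^ k)
    obtain ⟨sW, sn⟩ := hstep _ zW (x / β) (by linarith) (by linarith) zn
    have e1 : β * (x / β - (x / β - z)) = β * z := by ring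
    have e2 : β * (x / β - z) + ⌊β * z⌋ = x - greedyStep β z := by
      rw [greedyStep, Int.fract]
      field_simp
      ring
    rw [e1, e2] at sW sn
    rw [mul_div_cancel₀ _ hβ0.ne'] at sn
    exact ⟨Int.fract_nonneg _, Int.fract_lt_one _, sW, sn⟩

lemma betaIntegers_eq {β : ℝ} (hβ : 1 < β) {W : Set ℝ} (h0 : 0 ∈ W) (hW : ∀ w ∈ W, 0 ≤ w)
    (h1 : ∀ w ∈ W, w ≤ 0 ∨ 1 ≤ w)
    (hstep : ∀ g ∈ W, ∀ y, g ≤ y → y < g + 1 → (∀ w ∈ W, w ≤ g ∨ y < w) →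
      β * g + ⌊β * (y - g)⌋ ∈ W ∧ ∀ w ∈ W, w ≤ β * g + ⌊β * (y - g)⌋ ∨ β * y < w) :
    betaIntegers β = W := by
  ext x
  constructor
  · rintro ⟨hx, k, hk, hz⟩
    have := (greedy_remainder hβ h0 h1 hstep k x hx hk).2.2.1
    rwa [hz, sub_zero] at this
  -- A point of W is the largest element of W not exceeding itself, so its remainder vanishes.
  · intro hxW
    obtain ⟨k, hk⟩ := pow_unbounded_of_one_lt x hβ
    obtain ⟨z0, -, -, zn⟩ := greedy_remainder hβ h0 h1 hstep k x (hW x hxW) hk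
    refine ⟨hW x hxW, k, hk, le_antisymm ?_ z0⟩
    rcases zn x hxW with h | h
    · linarith
    · exact absurd h (lt_irrefl x)

/-! ### Units of norm `-1` -/

/-- The cut-and-project set of a quadratic unit `β` with conjugate `-1 / β`. -/
def negModelSet (β : ℝ) : Set ℝ :=
  {x | 0 ≤ x ∧ ∃ p q : ℤ, x = p + q / β ∧ -1 < p - β * q ∧ p - β * q < β}

/-- Differences of points with conjugates in (-1, β) have conjugate in (-(1+β), 1+β); so 1/β is the
only distance below 1 between such points. -/
lemma eq_of_neg_conj_bound {β : ℝ} (hβ : 1 < β) {p q : ℤ} (h0 : 0 < p + q / β)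
    (h1 : p + q / β < 1) (hl : -(1 + β) < p - β * q) (hu : p - β * q < 1 + β) : p = 0 ∧ q = 1 := by
  have hγ : 0 < 1 / β := by positivity
  have hγ1 : 1 / β < 1 := by rw [div_lt_one (by linarith)]; exact hβ
  rw [div_eq_mul_one_div] at h0 h1
  rcases lt_trichotomy q 0 with hq | rfl | hq
  · have hq' : (q : ℝ) ≤ -1 := by exact_mod_cast Int.le_sub_one_of_lt hq
    have : (0 : ℝ) < p := by nlinarith
    have : (1 : ℝ) ≤ p := by exact_mod_cast this
    nlinarith
  · simp only [Int.cast_zero, zero_mul, add_zero] at h0 h1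
    have a1 : 0 < p := by exact_mod_cast h0
    have a2 : p < 1 := by exact_mod_cast h1
    omega
  · have hq' : (1 : ℝ) ≤ q := by exact_mod_cast hq
    have : (p : ℝ) < 1 := by nlinarith
    have hp : p < 1 := by exact_mod_cast this
    have hp' : (p : ℝ) ≤ 0 := by exact_mod_cast Int.lt_add_one_iff.1 hp
    have : (q : ℝ) < 2 := by nlinarith
    have hq2 : q < 2 := by exact_mod_cast this
    obtain rfl : q = 1 := by omega
    have : (-1 : ℝ) < p := by push_cast at h0; linarith
    have : -1 < p := by exact_mod_cast this
    omega

lemma betaIntegers_eq_negModelSet {β : ℝ} (hβ : 1 < β) {a : ℤ} (ha : β = a + 1 / β) :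
    betaIntegers β = negModelSet β := by
  have hβ0 : 0 < β := by linarith
  have hγ : 0 < 1 / β := by positivity
  have hγ1 : 1 / β < 1 := by rw [div_lt_one hβ0]; exact hβ
  have hγβ : β * (1 / β) = 1 := by field_simp
  refine betaIntegers_eq hβ ⟨le_rfl, 0, 0, by simp, by simp, by simpa using hβ0⟩
    (fun w hw => hw.1) ?_ ?_
  · rintro w ⟨hw0, p, q, hw, hl, hu⟩
    by_contra! hc
    obtain ⟨rfl, rfl⟩ := eq_of_neg_conj_bound hβ (hw ▸ hc.1) (hw ▸ hc.2) (by linarith) (by linarith)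
    push_cast at hl
    linarith
  · rintro g ⟨hg0, p, q, hg, hl, hu⟩ y hgy hyg hn
    have hfl := Int.floor_le (β * (y - g))
    have hfu := Int.lt_floor_add_one (β * (y - g))
    have hd0 : 0 ≤ ⌊β * (y - g)⌋ := Int.floor_nonneg.2 (mul_nonneg hβ0.le (by linarith))
    set d := ⌊β * (y - g)⌋
    have hd0' : (0 : ℝ) ≤ d := by exact_mod_cast hd0
    have hda : (d : ℝ) ≤ a := by
      have h1 : (d : ℝ) < a + 1 := by nlinarith
      have h2 : d < a + 1 := by exact_mod_cast h1
      exact_mod_cast Int.lt_add_one_iff.1 h2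
    have hrep : β * g + d = ((a * p + q + d : ℤ) : ℝ) + (p : ℤ) / β := by
      rw [hg]; push_cast
      rw [show (a : ℝ) = β - 1 / β by linarith]
      field_simp
      ring
    have hconj : ((a * p + q + d : ℤ) : ℝ) - β * (p : ℤ) = -(1 / β) * (p - β * q) + d := by
      push_cast
      nth_rewrite 1 [ha]
      field_simp
      ring
    -- The new conjugate is -g'/β + d with -1 < g' < β and 0 ≤ d ≤ a; the upper end uses a + 1/β =
    -- β.
    have hl' : -1 < -(1 / β) * (p - β * q) + d := by nlinarith
    have hu' : -(1 / β) * (p - β * q) + d < β := by nlinarith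
    refine ⟨⟨by positivity, _, _, hrep, by rwa [hconj], by rwa [hconj]⟩, ?_⟩
    rintro w ⟨hw0, P, Q, hw, hwl, hwu⟩
    -- A larger w ≤ βy would lie 1/β above βg + d, so its conjugate w' would be in (-1, 0). Then w/β
    -- has conjugate -βw' in (0, β), so it is a window point in (g, y], against the maximality of g.
    by_contra! hc
    rw [← hconj] at hl' hu'
    have hdiff : w - (β * g + d) = ((P - (a * p + q + d) : ℤ) : ℝ) + ((Q - p : ℤ) : ℝ) / β := by
      rw [hrep, hw]; push_cast; ring
    obtain ⟨e1, e2⟩ := eq_of_neg_conj_bound hβ (p := P - (a * p + q + d)) (q := Q - p)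
      (by rw [← hdiff]; linarith) (by rw [← hdiff]; linarith)
      (by push_cast at *; linarith) (by push_cast at *; linarith)
    obtain rfl : P = a * p + q + d := by omega
    obtain rfl : Q = p + 1 := by omega
    have hwneg : ((a * p + q + d : ℤ) : ℝ) - β * ((p + 1 : ℤ) : ℝ) < 0 := by
      push_cast at *; linarith
    set P := a * p + q + d
    set Q := p + 1
    have hvrep : w / β = ((Q : ℤ) : ℝ) + ((P - a * Q : ℤ) : ℝ) / β := by
      rw [hw]; push_cast
      have : (Q : ℝ) / β = Q * (β - a) := by rw [div_eq_mul_one_div]; congr 1; linarith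
      rw [this]; field_simp; ring
    have hvconj : ((Q : ℤ) : ℝ) - β * ((P - a * Q : ℤ) : ℝ) = -β * (P - β * Q) := by
      push_cast
      have : (a : ℝ) = β - 1 / β := by linarith
      rw [this]; field_simp; ring
    rcases hn (w / β) ⟨by positivity, _, _, hvrep, by rw [hvconj]; nlinarith,
      by rw [hvconj]; nlinarith⟩ with h | h
    · rw [div_le_iff₀ hβ0] at h
      linarith
    · rw [lt_div_iff₀ hβ0] at h
      linarith

lemma range_twoGapSeq_eq_negModelSet {β : ℝ} (hβ : 1 < β) (hirr : Irrational β) :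
    range (twoGapSeq (1 - 1 / β) (1 + β) 1) = negModelSet β := by
  have hβ0 : 0 < β := by linarith
  have hγ : 0 < 1 / β := by positivity
  have hγ1 : 1 / β < 1 := by rw [div_lt_one hβ0]; exact hβ
  have hθ : 0 < 1 + β := by linarith
  ext x
  constructor
  · rintro ⟨n, rfl⟩
    have hmono := (strictMono_twoGapSeq (δ := 1 - 1 / β) (θ := 1 + β) (e := 1)
      (by linarith) (by linarith) (by linarith)).monotone (Nat.zero_le n)
    rw [twoGapSeq_zero (by linarith) zero_le_one (by linarith)] at hmono
    have hl := Int.floor_le (((n : ℝ) + 1) / (1 + β))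
    have hu := Int.lt_floor_add_one (((n : ℝ) + 1) / (1 + β))
    refine ⟨hmono, n - ⌊((n : ℝ) + 1) / (1 + β)⌋, ⌊((n : ℝ) + 1) / (1 + β)⌋, ?_, ?_, ?_⟩
    · unfold twoGapSeq; push_cast; ring
    · set S := ⌊((n : ℝ) + 1) / (1 + β)⌋
      rw [le_div_iff₀ hθ] at hl
      -- The window is open at -1 while the floor allows equality; irrationality of β excludes it.
      have hne : (S : ℝ) * (1 + β) ≠ n + 1 := by
        intro h
        have hS : (S : ℝ) ≠ 0 := by
          intro h0
          rw [h0, zero_mul] at h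
          have : (0 : ℝ) ≤ n := n.cast_nonneg
          linarith
        refine hirr ⟨((n : ℚ) + 1) / S - 1, ?_⟩
        push_cast
        rw [← h]
        field_simp
        ring
      have := lt_of_le_of_ne hl hne
      push_cast
      linarith
    · rw [div_lt_iff₀ hθ] at hu
      push_cast
      linarith
  · rintro ⟨hx, p, q, rfl, hl, hu⟩
    rw [div_eq_mul_one_div] at hx
    have hq : 0 ≤ q := by
      by_contra! hq
      have hq' : (q : ℝ) ≤ -1 := by exact_mod_cast Int.le_sub_one_of_lt hq
      have : (0 : ℝ) < p := by nlinarith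
      have : (1 : ℝ) ≤ p := by exact_mod_cast this
      nlinarith
    have hq' : (0 : ℝ) ≤ q := by exact_mod_cast hq
    have hp : 0 ≤ p := by
      have : (-1 : ℝ) < p := by nlinarith
      have : -1 < p := by exact_mod_cast this
      omega
    obtain ⟨n, hn⟩ := Int.eq_ofNat_of_zero_le (add_nonneg hp hq)
    have hn' : (n : ℝ) = p + q := by exact_mod_cast hn.symm
    refine ⟨n, ?_⟩
    have hfl : ⌊((n : ℝ) + 1) / (1 + β)⌋ = q := by
      rw [Int.floor_eq_iff, le_div_iff₀ hθ, div_lt_iff₀ hθ, hn']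
      constructor <;> linarith
    rw [twoGapSeq, hfl, hn']
    ring

/-! ### Units of norm `1` -/

/-- The cut-and-project set of a quadratic unit `β` with conjugate `1 / β`. -/
def posModelSet (β : ℝ) : Set ℝ :=
  {x | 0 ≤ x ∧ ∃ p q : ℤ, x = p + q / β ∧ 0 ≤ p + β * q ∧ p + β * q < β}

/-- Here differences have conjugate in (-β, β), and the only distance below 1 is 1 - 1/β. -/
lemma eq_of_pos_conj_bound {β : ℝ} (hβ : 2 < β) {p q : ℤ} (h0 : 0 < p + q / β)
    (h1 : p + q / β < 1) (hl : -β < p + β * q) (hu : p + β * q < β) : p = 1 ∧ q = -1 := by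
  have hβ0 : 0 < β := by linarith
  have hγ : 0 < 1 / β := by positivity
  have hγ1 : 1 / β < 1 / 2 := one_div_lt_one_div_of_lt two_pos hβ
  rw [div_eq_mul_one_div] at h0 h1
  rcases lt_trichotomy q 0 with hq | rfl | hq
  · have hq' : (q : ℝ) ≤ -1 := by exact_mod_cast Int.le_sub_one_of_lt hq
    have : (-2 : ℝ) < q := by nlinarith
    have hq2 : -2 < q := by exact_mod_cast this
    obtain rfl : q = -1 := by omega
    push_cast at h0 h1
    have a1 : (0 : ℝ) < p := by linarith
    have a2 : (p : ℝ) < 2 := by linarith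
    have a1 : 0 < p := by exact_mod_cast a1
    have a2 : p < 2 := by exact_mod_cast a2
    omega
  · simp only [Int.cast_zero, zero_mul, add_zero] at h0 h1
    have a1 : 0 < p := by exact_mod_cast h0
    have a2 : p < 1 := by exact_mod_cast h1
    omega
  · have hq' : (1 : ℝ) ≤ q := by exact_mod_cast hq
    have : (q : ℝ) < 2 := by nlinarith
    have hq2 : q < 2 := by exact_mod_cast this
    obtain rfl : q = 1 := by omega
    push_cast at h0 hu
    have : (-1 : ℝ) < p := by linarith
    have : -1 < p := by exact_mod_cast this
    have : (0 : ℝ) ≤ p := by exact_mod_cast (show 0 ≤ p by omega)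
    linarith

lemma betaIntegers_eq_posModelSet {β : ℝ} (hβ : 2 < β) {a : ℤ} (ha : β = a - 1 / β) :
    betaIntegers β = posModelSet β := by
  have hβ0 : 0 < β := by linarith
  have hγ : 0 < 1 / β := by positivity
  have hγ1 : 1 / β < 1 / 2 := one_div_lt_one_div_of_lt two_pos hβ
  have hγβ : β * (1 / β) = 1 := by field_simp
  refine betaIntegers_eq (by linarith) ⟨le_rfl, 0, 0, by simp, by simp, by simpa using hβ0⟩
    (fun w hw => hw.1) ?_ ?_
  · rintro w ⟨hw0, p, q, hw, hl, hu⟩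
    by_contra! hc
    obtain ⟨rfl, rfl⟩ := eq_of_pos_conj_bound hβ (hw ▸ hc.1) (hw ▸ hc.2) (by linarith) hu
    push_cast at hl
    linarith
  · rintro g ⟨hg0, p, q, hg, hl, hu⟩ y hgy hyg hn
    have hfl := Int.floor_le (β * (y - g))
    have hfu := Int.lt_floor_add_one (β * (y - g))
    have hd0 : 0 ≤ ⌊β * (y - g)⌋ := Int.floor_nonneg.2 (mul_nonneg hβ0.le (by linarith))
    set d := ⌊β * (y - g)⌋
    have hd0' : (0 : ℝ) ≤ d := by exact_mod_cast hd0
    have hda : (d : ℝ) ≤ a - 1 := by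
      have h1 : (d : ℝ) < a := by nlinarith
      have h2 : d < a := by exact_mod_cast h1
      exact_mod_cast Int.le_sub_one_of_lt h2
    have hrep : β * g + d = ((a * p + q + d : ℤ) : ℝ) + (-p : ℤ) / β := by
      rw [hg]; push_cast
      rw [show (a : ℝ) = β + 1 / β by linarith]
      field_simp
      ring
    have hconj : ((a * p + q + d : ℤ) : ℝ) + β * (-p : ℤ) = 1 / β * (p + β * q) + d := by
      push_cast
      nth_rewrite 1 [ha]
      field_simp
      ring
    have hl' : 0 ≤ 1 / β * (p + β * q) + d := by positivity
    have hu' : 1 / β * (p + β * q) + d < β := by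
      -- If g' < β - 1, then d ≤ a - 1 suffices. Otherwise g + 1 - 1/β is also a window point, so
      -- maximality of g forces y below it, and the digit drops to at most a - 2.
      rcases lt_or_ge ((p : ℝ) + β * q) (β - 1) with hlt | hge
      · nlinarith
      · have hgap : y < g + (1 - 1 / β) := by
          have hmem : g + (1 - 1 / β) ∈ posModelSet β := by
            refine ⟨by linarith, p + 1, q - 1, ?_, ?_, ?_⟩
            · rw [hg]; push_cast; ring
            · push_cast; linarith
            · push_cast; linarith
          rcases hn _ hmem with h | h
          · linarith
          · exact h
        have hda2 : (d : ℝ) ≤ a - 2 := by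
          have h1 : (d : ℝ) < a - 1 := by nlinarith
          have h2 : d < a - 1 := by exact_mod_cast h1
          exact_mod_cast (show d ≤ a - 2 by omega)
        nlinarith
    refine ⟨⟨by positivity, _, _, hrep, by rwa [hconj], by rwa [hconj]⟩, ?_⟩
    rintro w ⟨hw0, P, Q, hw, hwl, hwu⟩
    by_contra! hc
    rw [← hconj] at hl' hu'
    have hdiff : w - (β * g + d) = ((P - (a * p + q + d) : ℤ) : ℝ) + ((Q - -p : ℤ) : ℝ) / β := by
      rw [hrep, hw]; push_cast; ring
    obtain ⟨e1, e2⟩ := eq_of_pos_conj_bound hβ (p := P - (a * p + q + d)) (q := Q - -p)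
      (by rw [← hdiff]; linarith) (by rw [← hdiff]; linarith)
      (by push_cast at *; linarith) (by push_cast at *; linarith)
    -- A larger w ≤ βy exceeds βg + d by 1 - 1/β, of conjugate 1 - β, so 0 ≤ w' < 1. Then w/β has
    -- conjugate βw' in [0, β) and contradicts the maximality of g.
    have hw1 : (P : ℝ) + β * Q < 1 := by
      obtain rfl : P = a * p + q + d + 1 := by omega
      obtain rfl : Q = -p - 1 := by omega
      push_cast at *; linarith
    have hvrep : w / β = ((-Q : ℤ) : ℝ) + ((P + a * Q : ℤ) : ℝ) / β := by
      rw [hw]; push_cast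
      have : (Q : ℝ) / β = Q * (a - β) := by rw [div_eq_mul_one_div]; congr 1; linarith
      rw [this]; field_simp; ring
    have hvconj : ((-Q : ℤ) : ℝ) + β * ((P + a * Q : ℤ) : ℝ) = β * (P + β * Q) := by
      push_cast
      have : (a : ℝ) = β + 1 / β := by linarith
      rw [this]; field_simp; ring
    rcases hn (w / β) ⟨by positivity, _, _, hvrep, by rw [hvconj]; positivity,
      by rw [hvconj]; nlinarith⟩ with h | h
    · rw [div_le_iff₀ hβ0] at h
      linarith
    · rw [lt_div_iff₀ hβ0] at h
      linarith

lemma range_twoGapSeq_eq_posModelSet {β : ℝ} (hβ : 2 < β) :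
    range (twoGapSeq (1 / β) β 0) = posModelSet β := by
  have hβ0 : 0 < β := by linarith
  have hγ : 0 < 1 / β := by positivity
  have hγ1 : 1 / β < 1 / 2 := one_div_lt_one_div_of_lt two_pos hβ
  ext x
  constructor
  · rintro ⟨n, rfl⟩
    have hmono := (strictMono_twoGapSeq (δ := 1 / β) (θ := β) (e := 0)
      hγ (by linarith) (by linarith)).monotone (Nat.zero_le n)
    rw [twoGapSeq_zero (by linarith) le_rfl hβ0] at hmono
    have hl := Int.floor_le (((n : ℝ) + 0) / β)
    have hu := Int.lt_floor_add_one (((n : ℝ) + 0) / β)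
    rw [le_div_iff₀ hβ0] at hl
    rw [div_lt_iff₀ hβ0] at hu
    refine ⟨hmono, n, -⌊((n : ℝ) + 0) / β⌋, ?_, ?_, ?_⟩
    · unfold twoGapSeq; push_cast; ring
    · push_cast; linarith
    · push_cast; linarith
  · rintro ⟨hx, p, q, rfl, hl, hu⟩
    rw [div_eq_mul_one_div] at hx
    have hp : 0 ≤ p := by
      by_contra! hp
      have hp' : (p : ℝ) ≤ -1 := by exact_mod_cast Int.le_sub_one_of_lt hp
      have h1 : (0 : ℝ) < q := by
        by_contra! h
        nlinarith
      have h2 : (1 : ℝ) ≤ q := by exact_mod_cast h1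
      have h3 : -(p : ℝ) * β ≤ q := by
        have := mul_le_mul_of_nonneg_right hx hβ0.le
        rw [zero_mul, add_mul, mul_assoc, one_div_mul_cancel hβ0.ne'] at this
        linarith
      nlinarith
    obtain ⟨n, rfl⟩ := Int.eq_ofNat_of_zero_le hp
    refine ⟨n, ?_⟩
    have hfl : ⌊((n : ℝ) + 0) / β⌋ = -q := by
      rw [Int.floor_eq_iff, le_div_iff₀ hβ0, div_lt_iff₀ hβ0]
      push_cast at *
      constructor <;> linarith
    rw [twoGapSeq, hfl]
    push_cast
    ring

/-! ### Quadratic units -/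

lemma IsQuadraticPVUnit.exists_eq {β : ℝ} (h : IsQuadraticPVUnit β) :
    ∃ a : ℤ, β = a + 1 / β ∨ β = a - 1 / β := by
  have hβ0 : 0 < β := one_pos.trans h.one_lt
  have hev : Polynomial.aeval β (minpoly ℤ β) = 0 := minpoly.aeval ℤ β
  have hlead : (minpoly ℤ β).coeff 2 = 1 := by
    have := minpoly.monic h.isIntegral
    rw [Polynomial.Monic, Polynomial.leadingCoeff, h.natDegree_minpoly] at this
    exact this
  rw [Polynomial.aeval_eq_sum_range, h.natDegree_minpoly] at hev
  simp only [Finset.sum_range_succ, Finset.range_zero, Finset.sum_empty, hlead, zsmul_eq_mul] at hev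
  refine ⟨-(minpoly ℤ β).coeff 1, ?_⟩
  rcases Int.isUnit_iff.1 h.isUnit with h0 | h0
  · right
    rw [h0] at hev
    push_cast at *
    field_simp
    linarith
  · left
    rw [h0] at hev
    push_cast at *
    field_simp
    linarith

lemma IsQuadraticPVUnit.irrational {β : ℝ} (h : IsQuadraticPVUnit β) : Irrational β := by
  rintro ⟨q, hq⟩
  have h1 : IsIntegral ℤ q := by
    have := h.isIntegral
    rw [← hq] at this
    exact (isIntegral_algebraMap_iff (algebraMap ℚ ℝ).injective).1 this
  obtain ⟨k, hk⟩ := IsIntegrallyClosed.isIntegral_iff.1 h1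
  have hβ : β = algebraMap ℤ ℝ k := by rw [← hq, ← hk]; simp
  have hdeg := h.natDegree_minpoly
  have : minpoly ℤ β = Polynomial.X - Polynomial.C k := by
    rw [hβ]; exact minpoly.eq_X_sub_C_of_algebraMap_inj k (algebraMap ℤ ℝ).injective_int
  rw [this, Polynomial.natDegree_X_sub_C] at hdeg
  omega

/-- The `β`-integers of a quadratic unit form a two-gap sequence that is close to linear. -/
lemma IsQuadraticPVUnit.exists_enumeration {β : ℝ} (h : IsQuadraticPVUnit β) :
    ∃ (b : ℕ → ℝ) (c : ℝ), StrictMono b ∧ range b = betaIntegers β ∧ 0 < c ∧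
      Tendsto (fun n : ℕ => b n / n) atTop (𝓝 c) ∧
      IsAlphaPerturbation (fun n : ℕ => b n / c - n) := by
  have hβ := h.one_lt
  have hβ0 : 0 < β := by linarith
  have hγ : 0 < 1 / β := by positivity
  have hγ1 : 1 / β < 1 := by rw [div_lt_one hβ0]; exact hβ
  have hγβ : β * (1 / β) = 1 := by field_simp
  obtain ⟨a, ha | ha⟩ := h.exists_eq
  · have hδ : 0 < 1 - 1 / β := by linarith
    have hδ1 : 1 - 1 / β < 1 := by linarith
    have hθ : 1 < 1 + β := by linarith
    have hθ2 : 1 / (1 + β) < 1 / 2 := one_div_lt_one_div_of_lt two_pos (by linarith)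
    have hθ0 : 0 < 1 / (1 + β) := by positivity
    refine ⟨_, _, strictMono_twoGapSeq (e := 1) hδ hδ1 hθ, ?_, two_gap_density_pos hδ hδ1 hθ,
      tendsto_twoGapSeq_div hδ hθ zero_le_one,
      isAlphaPerturbation_twoGapSeq hδ hδ1 hθ zero_le_one (by linarith) ?_ ?_⟩
    · rw [range_twoGapSeq_eq_negModelSet hβ h.irrational, betaIntegers_eq_negModelSet hβ ha]
    · rw [div_eq_mul_one_div (1 - 1 / β) (1 + β)]
      nlinarith
    · rw [div_eq_mul_one_div (1 - 1 / β) (1 + β)]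
      nlinarith
  -- Since a - 2 = (β - 1)²/β > 0, the integer a is at least 3, and β = a - 1/β > 2.
  · have hβ2 : 2 < β := by
      have h1 : (2 : ℝ) < a := by
        have : (a : ℝ) - 2 = (β - 1) ^ 2 / β := by
          rw [show (a : ℝ) = β + 1 / β by linarith]; field_simp; ring
        have : 0 < (β - 1) ^ 2 / β := div_pos (pow_pos (by linarith) 2) hβ0
        linarith
      have h2 : 2 < a := by exact_mod_cast h1
      have h3 : (3 : ℝ) ≤ a := by exact_mod_cast h2
      linarith
    have hγ2 : 1 / β < 1 / 2 := one_div_lt_one_div_of_lt two_pos hβ2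
    refine ⟨_, _, strictMono_twoGapSeq (e := 0) hγ hγ1 hβ, ?_, two_gap_density_pos hγ hγ1 hβ,
      tendsto_twoGapSeq_div hγ hβ le_rfl,
      isAlphaPerturbation_twoGapSeq hγ hγ1 hβ le_rfl hβ0 ?_ ?_⟩
    · rw [range_twoGapSeq_eq_posModelSet hβ2, betaIntegers_eq_posModelSet hβ2 ha]
    · rw [zero_div, mul_zero]
      exact two_gap_density_pos hγ hγ1 hβ
    · rw [zero_div, sub_zero, mul_one, div_eq_mul_one_div (1 / β) β]
      nlinarith

end DelonePerturbation

theorem mainTheorem2 :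
    (∀ (α : ℕ → ℝ) (A : ℝ → ℝ) (x : ℕ → ℝ),
      DelonePerturbation.IsAlphaPerturbation α →
      DelonePerturbation.IsMildExtension α A →
      (∀ n : ℕ, x n = n + α n) →
      -- the series and the integrals converge
      (∀ t : ℝ, Summable fun n : ℕ => t ^ n / DelonePerturbation.seqFactorial x n) ∧
      (∀ m : ℕ, IntegrableOn
        (fun t : ℝ => (t ^ m / DelonePerturbation.seqFactorial x m) /
          ∑' n : ℕ, t ^ n / DelonePerturbation.seqFactorial x n) (Ioi 0)) ∧
      Tendsto (fun m : ℕ => ∫ t in Ioi (0 : ℝ), (t ^ m / DelonePerturbation.seqFactorial x m) /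
          ∑' n : ℕ, t ^ n / DelonePerturbation.seqFactorial x n) atTop (𝓝 1) ∧
      Tendsto (DelonePerturbation.momentRatio x) atTop (𝓝 1) ∧
      Tendsto (fun n : ℕ => DelonePerturbation.renormalized x n / x n) atTop (𝓝 1)) ∧
    (∀ β : ℝ, DelonePerturbation.IsQuadraticPVUnit β →
      ∃ (b : ℕ → ℝ) (c : ℝ),
        -- `b` enumerates the nonnegative `β`-integers increasingly, and `c = lim b n / n`
        StrictMono b ∧ range b = DelonePerturbation.betaIntegers β ∧
        0 < c ∧ Tendsto (fun n : ℕ => b n / n) atTop (𝓝 c) ∧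
        -- the rescaled sequence `b n / c` satisfies the hypotheses of the first part
        DelonePerturbation.IsAlphaPerturbation (fun n : ℕ => b n / c - n) ∧
        (∃ A : ℝ → ℝ, DelonePerturbation.IsMildExtension (fun n : ℕ => b n / c - n) A) ∧
        -- and hence also its conclusion
        Tendsto (DelonePerturbation.momentRatio fun n : ℕ => b n / c) atTop (𝓝 1) ∧
        Tendsto (fun n : ℕ => DelonePerturbation.renormalized (fun k : ℕ => b k / c) n / (b n / c))
          atTop (𝓝 1)) := by
  refine ⟨fun α A x hα _ hx => ?_, fun β hβ => ?_⟩
  · obtain ⟨r, h⟩ := hα.exists_isBracketed hx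
    exact ⟨h.summable_pow_div_seqFactorial, h.integrableOn_integrand, h.tendsto_integral,
      h.tendsto_momentRatio, h.tendsto_renormalized_div⟩
  · obtain ⟨b, c, hb, hr, hc, hlim, hα⟩ := hβ.exists_enumeration
    obtain ⟨r, h⟩ := hα.exists_isBracketed (x := fun n => b n / c) (fun n => by ring)
    exact ⟨b, c, hb, hr, hc, hlim, hα,
      ⟨_, DelonePerturbation.isMildExtension_linearInterpolation hα.mem_Ioo⟩,
      h.tendsto_momentRatio, h.tendsto_renormalized_div⟩
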